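/- Consider the quadratic family $f : \mathbb{C}^2 \to \mathbb{C}^2$, $f(z,\lambda) = (f_\lambda(z), \lambda)$ with $f_\lambda(z) = z^2 + \lambda$, and let $$\mathcal{K} = \{(z,\lambda) \in \mathbb{C}^2 : \text{the orbit } (f_\lambda^n(z))_{n \ge 0} \text{ is bounded}\}.$$ Every algebraic curve $Z \subset \mathbb{C}^2$ (that is, the zero set of a nonconstant polynomial in $\mathbb{C}[z,\lambda]$, possibly reducible) that is contained in $\mathcal{K}$ is preperiodic under $f$: there exist integers $n \ge 0$ and $m \ge 1$ with $f^{n+m}(Z) = f^n(Z)$. -/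

import Mathlib

namespace QuadraticFamily

/-- The quadratic polynomial `f_c(z) = z ^ 2 + c` on the complex plane. -/
def quadMap (c z : ℂ) : ℂ := z ^ 2 + c

/-- The quadratic family, as the self-map `(z, c) ↦ (f_c(z), c)` of `ℂ × ℂ`. -/
def family (p : ℂ × ℂ) : ℂ × ℂ := (quadMap p.2 p.1, p.2)

/-- The filled Julia set of `f_c`: the points whose forward orbit under `f_c` is bounded. -/
def filledJulia (c : ℂ) : Set ℂ :=
  {z | Bornology.IsBounded (Set.range fun n : ℕ => (quadMap c)^[n] z)}

/-- The union over all parameters `c` of the sets `K_c × {c}`. -/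
def filledJuliaTotal : Set (ℂ × ℂ) := {p | p.1 ∈ filledJulia p.2}

/-- A (closed, possibly reducible) affine plane algebraic curve: the zero set of a nonconstant
polynomial in two variables with complex coefficients. -/
def IsAlgebraicCurve (Z : Set (ℂ × ℂ)) : Prop :=
  ∃ P : MvPolynomial (Fin 2) ℂ, (∀ a : ℂ, P ≠ MvPolynomial.C a) ∧
    Z = {p : ℂ × ℂ | MvPolynomial.eval ![p.1, p.2] P = 0}

/-- A set is preperiodic under a self-map `g` if `g^(n+m)(Z) = g^n(Z)` for some `n ≥ 0`
and `m ≥ 1`. -/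
def IsPreperiodicSet {X : Type*} (g : X → X) (Z : Set X) : Prop :=
  ∃ n m : ℕ, 0 < m ∧ g^[n + m] '' Z = g^[n] '' Z

end QuadraticFamily

namespace QuadraticFamily

open Polynomial Filter Topology

/-! At `λ = -t²` with `t → ∞`, the filled Julia set lies in two discs of radius 3 about `±t`, and
two of its points with the same first two symbols (which disc each visits) are `O(1/t)` apart
(`norm_sub_le_div`). The curve has a fixed number `d` of points over each `λ`, so for `λ = -k²` the
two-symbol words of all `d` orbits at time `n` take finitely many values. By pigeonhole some times
`n < m` agree for infinitely many `k`, and along these `g = f^m - f^n` tends to 0 at all `d` points.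

If `g` takes the value `e` on the curve, the norm of `e - g` over the `λ`-line is a polynomial in
`λ` (`exists_eval_eq_prod_roots`). It tends to a nonzero multiple of `e^d`, hence is constant; it
also vanishes somewhere, so `e = 0`. Thus `f^m = f^n` pointwise on the curve. -/

/-! ### Escape radius and invariance. -/

lemma mem_filledJulia_iff {c z : ℂ} :
    z ∈ filledJulia c ↔ Bornology.IsBounded (Set.range fun n : ℕ => (quadMap c)^[n] z) :=
  Iff.rfl

/-- The escape radius: a point of the filled Julia set of `f_c` has modulus at most
`2 + √|c|`. -/
lemma norm_le_of_mem_filledJulia {c z : ℂ} (hz : z ∈ filledJulia c) :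
    ‖z‖ ≤ 2 + √‖c‖ := by
  by_contra! h
  have ht : 0 ≤ √‖c‖ := Real.sqrt_nonneg _
  have ht2 : √‖c‖ ^ 2 = ‖c‖ := Real.sq_sqrt (norm_nonneg _)
  have step : ∀ w : ℂ, 2 + √‖c‖ ≤ ‖w‖ → 2 * ‖w‖ ≤ ‖quadMap c w‖ := by
    intro w hw
    have h1 : ‖w ^ 2‖ - ‖c‖ ≤ ‖w ^ 2 + c‖ := by
      linarith [norm_sub_le_norm_add (w ^ 2) c]
    rw [norm_pow] at h1
    have h2 : 0 ≤ (‖w‖ - (2 + √‖c‖)) * ‖w‖ :=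
      mul_nonneg (by linarith) (norm_nonneg _)
    unfold quadMap
    nlinarith [mul_nonneg ht (norm_nonneg w)]
  have grow : ∀ n : ℕ, 2 + √‖c‖ + n ≤ ‖(quadMap c)^[n] z‖ := by
    intro n
    induction n with
    | zero => simpa using h.le
    | succ n ih =>
      rw [Function.iterate_succ_apply']
      have hn : (0 : ℝ) ≤ n := n.cast_nonneg
      have := step _ (by linarith)
      push_cast
      linarith
  obtain ⟨M, hM⟩ := (mem_filledJulia_iff.1 hz).exists_norm_le
  obtain ⟨n, hn⟩ := exists_nat_gt M
  have := hM _ ⟨n, rfl⟩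
  have := grow n
  linarith

lemma quadMap_mem_filledJulia {c z : ℂ} (hz : z ∈ filledJulia c) :
    quadMap c z ∈ filledJulia c := by
  refine mem_filledJulia_iff.2 ((mem_filledJulia_iff.1 hz).subset ?_)
  rintro _ ⟨n, rfl⟩
  exact ⟨n + 1, rfl⟩

lemma iterate_mem_filledJulia {c z : ℂ} (hz : z ∈ filledJulia c) (n : ℕ) :
    (quadMap c)^[n] z ∈ filledJulia c := by
  induction n with
  | zero => exact hz
  | succ n ih =>
    rw [Function.iterate_succ_apply']
    exact quadMap_mem_filledJulia ih

lemma iterate_family (n : ℕ) (p : ℂ × ℂ) :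
    family^[n] p = ((quadMap p.2)^[n] p.1, p.2) := by
  induction n with
  | zero => rfl
  | succ n ih => rw [Function.iterate_succ_apply', Function.iterate_succ_apply', ih]; rfl

/-! ### Symbolic dynamics at the parameters `-t²`. -/

/-- For the parameter `-t²`, points of the filled Julia set are close to `t` or to `-t`. -/
lemma norm_sub_le_of_re_nonneg {t : ℝ} (ht : 1 ≤ t) {w : ℂ}
    (hw : w ∈ filledJulia (-(t : ℂ) ^ 2)) (hre : 0 ≤ w.re) : ‖w - t‖ ≤ 3 := by
  have h1 := norm_le_of_mem_filledJulia (quadMap_mem_filledJulia hw)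
  have hs : √‖-(t : ℂ) ^ 2‖ = t := by
    rw [norm_neg, norm_pow, Real.sqrt_sq (norm_nonneg _), Complex.norm_real, Real.norm_eq_abs,
      abs_of_nonneg (by linarith)]
  have h2 : quadMap (-(t : ℂ) ^ 2) w = (w - t) * (w + t) := by unfold quadMap; ring
  rw [hs, h2, norm_mul] at h1
  -- The image has modulus at most `2 + t`, so dividing by this factor leaves `‖w - t‖ ≤ (2 + t) / t
  -- ≤ 3`.
  have h3 : t ≤ ‖w + t‖ := by
    have := Complex.re_le_norm (w + t)
    simp at this
    linarith
  by_contra! h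
  nlinarith [norm_nonneg (w - t)]

/-- Reduces to the other half-plane: `w` and `-w` have the same image. -/
lemma norm_add_le_of_re_nonpos {t : ℝ} (ht : 1 ≤ t) {w : ℂ}
    (hw : w ∈ filledJulia (-(t : ℂ) ^ 2)) (hre : w.re ≤ 0) : ‖w + t‖ ≤ 3 := by
  have hq : ∀ n : ℕ, (quadMap (-(t : ℂ) ^ 2))^[n + 1] (-w) =
      (quadMap (-(t : ℂ) ^ 2))^[n + 1] w := by
    intro n
    rw [Function.iterate_succ_apply, Function.iterate_succ_apply]
    simp [quadMap]
  have hneg : -w ∈ filledJulia (-(t : ℂ) ^ 2) := by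
    refine mem_filledJulia_iff.2 (((mem_filledJulia_iff.1 hw).union
      (Bornology.isBounded_singleton (x := -w))).subset ?_)
    rintro _ ⟨n, rfl⟩
    rcases n with _ | n
    · right; rfl
    · left; exact ⟨n + 1, (hq n).symm⟩
  have := norm_sub_le_of_re_nonneg ht hneg (by simpa using hre)
  rwa [← norm_neg, show -(-w - (t : ℂ)) = w + t by ring] at this

/-- Two points of the same filled Julia set on the same side of the imaginary axis are within
bounded distance of one another, and their sum is large. -/
lemma norm_sub_le_and_le_norm_add {t : ℝ} (ht : 1 ≤ t) {v w : ℂ}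
    (hv : v ∈ filledJulia (-(t : ℂ) ^ 2)) (hw : w ∈ filledJulia (-(t : ℂ) ^ 2))
    (hre : 0 ≤ v.re ↔ 0 ≤ w.re) : ‖v - w‖ ≤ 6 ∧ 2 * t - 6 ≤ ‖v + w‖ := by
  have h2t : ‖(2 * t : ℂ)‖ = 2 * t := by
    rw [norm_mul, Complex.norm_real, Real.norm_eq_abs, abs_of_nonneg (by linarith)]; simp
  by_cases h : 0 ≤ v.re
  · have h1 := norm_sub_le_of_re_nonneg ht hv h
    have h2 := norm_sub_le_of_re_nonneg ht hw (hre.1 h)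
    constructor
    · have := norm_sub_le (v - t) (w - t)
      rw [show v - t - (w - t) = v - w by ring] at this
      linarith
    · have h3 := norm_sub_le (v + w) ((v - t) + (w - t))
      rw [show v + w - ((v - t) + (w - t)) = 2 * t by ring, h2t] at h3
      linarith [norm_add_le (v - t) (w - t)]
  · have h1 := norm_add_le_of_re_nonpos ht hv (not_le.1 h).le
    have h2 := norm_add_le_of_re_nonpos ht hw (not_le.1 (mt hre.2 h)).le
    constructor
    · have := norm_sub_le (v + t) (w + t)
      rw [show v + t - (w + t) = v - w by ring] at this
      linarith
    · have h3 := norm_sub_le ((v + t) + (w + t)) (v + w)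
      rw [show (v + t) + (w + t) - (v + w) = 2 * t by ring, h2t] at h3
      linarith [norm_add_le (v + t) (w + t)]

/-- Agreement of the second symbol bounds the difference of the images, `(v - w)(v + w)`, by 6;
agreement of the first makes `v + w` large. -/
lemma norm_sub_le_div {t : ℝ} (ht : 4 ≤ t) {v w : ℂ}
    (hv : v ∈ filledJulia (-(t : ℂ) ^ 2)) (hw : w ∈ filledJulia (-(t : ℂ) ^ 2))
    (h0 : 0 ≤ v.re ↔ 0 ≤ w.re)
    (h1 : 0 ≤ (quadMap (-(t : ℂ) ^ 2) v).re ↔ 0 ≤ (quadMap (-(t : ℂ) ^ 2) w).re) :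
    ‖v - w‖ ≤ 6 / (2 * t - 6) := by
  have hA := (norm_sub_le_and_le_norm_add (by linarith) hv hw h0).2
  have hB := (norm_sub_le_and_le_norm_add (by linarith) (quadMap_mem_filledJulia hv)
    (quadMap_mem_filledJulia hw) h1).1
  have hq : quadMap (-(t : ℂ) ^ 2) v - quadMap (-(t : ℂ) ^ 2) w = (v - w) * (v + w) := by
    unfold quadMap; ring
  rw [hq, norm_mul] at hB
  rw [le_div_iff₀ (by linarith)]
  exact (mul_le_mul_of_nonneg_left hA (norm_nonneg _)).trans hB

/-! ### Algebraic and combinatorial tools. -/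

/-- The polynomial in `z` over `ℂ[λ]` representing `f_λ^n(z)`. -/
noncomputable def iteratePoly : ℕ → ℂ[X][X]
  | 0 => X
  | n + 1 => iteratePoly n ^ 2 + C X

lemma evalEval_iteratePoly (c z : ℂ) (n : ℕ) :
    (iteratePoly n).evalEval c z = (quadMap c)^[n] z := by
  induction n with
  | zero => simp [iteratePoly]
  | succ n ih =>
    rw [Function.iterate_succ_apply', ← ih]
    simp [iteratePoly, quadMap, evalEval_C]

/-- A multiset of cardinality `d` is the family of values of a function on `Fin d`. -/
lemma exists_fin_enumeration {α : Type*} {d : ℕ} (s : Multiset α) (hs : s.card = d) :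
    ∃ z : Fin d → α, s = Finset.univ.val.map z := by
  obtain ⟨l, rfl⟩ : ∃ l : List α, s = (l : Multiset α) := ⟨s.toList, s.coe_toList.symm⟩
  obtain rfl : l.length = d := by simpa using hs
  exact ⟨l.get, by rw [Fin.univ_val_map, List.ofFn_get]⟩

/-- A polynomial converging to `b` along a filter on which the variable tends to infinity is the
constant `b`. -/
lemma eq_C_of_tendsto {ι : Type*} {l : Filter ι} [l.NeBot] {u : ι → ℂ}
    (hu : Tendsto (fun i => ‖u i‖) l atTop) (R : ℂ[X]) {b : ℂ}
    (hR : Tendsto (fun i => R.eval (u i)) l (𝓝 b)) : R = C b := by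
  by_cases hd : 0 < R.degree
  · exact absurd hR.norm (not_tendsto_nhds_of_tendsto_atTop (R.tendsto_norm_atTop hd hu) _)
  · rw [eq_C_of_degree_le_zero (not_lt.1 hd)] at hR ⊢
    simp only [eval_C] at hR
    rw [tendsto_nhds_unique hR tendsto_const_nhds]

/-- Among sequences `s k` in a finite type, infinitely many repeat a value at the same two
indices. -/
lemma exists_lt_infinite_setOf_eq {α : Type*} [Finite α] (s : ℕ → ℕ → α) :
    ∃ n m : ℕ, n < m ∧ {k | s k n = s k m}.Infinite := by
  have hex : ∀ k, ∃ q : Fin (Nat.card α + 1) × Fin (Nat.card α + 1),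
      q.1 < q.2 ∧ s k q.1 = s k q.2 := by
    intro k
    have := Fintype.ofFinite α
    obtain ⟨a, b, hab, h⟩ := Fintype.exists_ne_map_eq_of_card_lt
      (fun i : Fin (Nat.card α + 1) => s k i) (by simp)
    rcases lt_or_gt_of_ne hab with hlt | hlt
    · exact ⟨(a, b), hlt, h⟩
    · exact ⟨(b, a), hlt, h.symm⟩
  choose q hlt hq using hex
  obtain ⟨y, hy⟩ := Finite.exists_infinite_fiber q
  have hy' : (q ⁻¹' {y}).Infinite := Set.infinite_coe_iff.1 hy
  obtain ⟨k, hk⟩ := hy'.nonempty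
  refine ⟨y.1, y.2, ?_, hy'.mono ?_⟩
  · have := hlt k
    rw [show q k = y from hk] at this
    exact this
  · intro j hj
    have := hq j
    rwa [show q j = y from hj] at this

/-! ### Fibres of the curve over the parameter line. -/

lemma evalEval_eq_zero_of_mem_roots {p : ℂ[X][X]} {c z : ℂ}
    (hz : z ∈ (p.map (evalRingHom c)).roots) : p.evalEval c z = 0 := by
  rw [← map_evalRingHom_eval]
  exact (mem_roots'.1 hz).2

/-- Factor over the roots, each bounded by the escape radius. The bound is locally uniform in `c`,
so it survives a limit where the leading coefficient vanishes. -/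
lemma norm_evalEval_le {p : ℂ[X][X]}
    (hp : ∀ c z, p.evalEval c z = 0 → z ∈ filledJulia c) {c : ℂ}
    (hc : p.leadingCoeff.eval c ≠ 0) (z : ℂ) :
    ‖p.evalEval c z‖ ≤ ‖p.leadingCoeff.eval c‖ * (‖z‖ + (2 + √‖c‖)) ^ p.natDegree := by
  set P := p.map (evalRingHom c) with hP
  have hdeg : P.natDegree = p.natDegree := natDegree_map_of_leadingCoeff_ne_zero _ (by simpa)
  have hlead : P.leadingCoeff = p.leadingCoeff.eval c := by
    rw [leadingCoeff, hdeg, hP, coeff_map]; rfl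
  have hsplit : P.Splits := IsAlgClosed.splits P
  rw [← map_evalRingHom_eval, ← hP, hsplit.eval_eq_prod_roots, hlead, norm_mul]
  gcongr
  obtain ⟨r, hr⟩ := exists_fin_enumeration P.roots
    (hsplit.natDegree_eq_card_roots.symm.trans hdeg)
  rw [hr, Multiset.map_map]
  change ‖∏ i, (z - r i)‖ ≤ _
  rw [norm_prod]
  refine (Finset.prod_le_prod (fun _ _ => norm_nonneg _) (g := fun _ => ‖z‖ + (2 + √‖c‖))
    fun i _ => ?_).trans (by simp)
  refine (norm_sub_le _ _).trans ?_
  gcongr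
  refine norm_le_of_mem_filledJulia (hp _ _ (evalEval_eq_zero_of_mem_roots ?_))
  rw [← hP, hr]
  exact Multiset.mem_map_of_mem _ (Finset.mem_univ i)

/-- A plane curve inside the total filled Julia set has no vertical asymptote. -/
lemma leadingCoeff_eval_ne_zero {p : ℂ[X][X]}
    (hp : ∀ c z, p.evalEval c z = 0 → z ∈ filledJulia c) (c : ℂ) :
    p.leadingCoeff.eval c ≠ 0 := by
  intro h0
  -- Otherwise the whole vertical line over `c` would lie in the filled Julia set, which is bounded.
  suffices hv : ∀ z, p.evalEval c z = 0 by
    have h := norm_le_of_mem_filledJulia (hp c _ (hv ((3 + √‖c‖ : ℝ) : ℂ)))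
    rw [Complex.norm_real, Real.norm_eq_abs, abs_of_nonneg (by positivity)] at h
    linarith
  intro z
  by_cases hp0 : p = 0
  · simp [hp0]
  have hev : ∀ᶠ x in 𝓝[≠] c, p.leadingCoeff.eval x ≠ 0 := by
    have hfin : (p.leadingCoeff.rootSet ℂ).Finite := rootSet_finite _ _
    have h1 : (p.leadingCoeff.rootSet ℂ \ {c})ᶜ ∈ 𝓝 c :=
      hfin.sdiff.isClosed.compl_mem_nhds fun h => h.2 rfl
    filter_upwards [mem_nhdsWithin_of_mem_nhds h1, self_mem_nhdsWithin] with x hx hxc hx0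
    refine hx ⟨?_, hxc⟩
    rw [mem_rootSet]
    exact ⟨leadingCoeff_ne_zero.2 hp0, by simpa using hx0⟩
  have hcont : Continuous fun x => p.evalEval x z := by
    simp only [evalEval]
    exact (p.eval (C z)).continuous
  have hL := (hcont.norm.tendsto c).mono_left (nhdsWithin_le_nhds (s := {c}ᶜ))
  have hRc : Continuous fun x : ℂ =>
      ‖p.leadingCoeff.eval x‖ * (‖z‖ + (2 + √‖x‖)) ^ p.natDegree := by
    have := p.leadingCoeff.continuous
    fun_prop
  have hR := (hRc.tendsto c).mono_left (nhdsWithin_le_nhds (s := {c}ᶜ))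
  have := le_of_tendsto_of_tendsto hL hR (hev.mono fun x hx => norm_evalEval_le hp hx z)
  simpa [h0] using this

/-- The norm of `g` with respect to the curve `p = 0`, as a polynomial in the parameter. -/
lemma exists_eval_eq_prod_roots {p : ℂ[X][X]} (hp : ∀ c, p.leadingCoeff.eval c ≠ 0)
    (g : ℂ[X][X]) : ∃ (a : ℂ) (R : ℂ[X]), a ≠ 0 ∧ ∀ c, R.eval c =
      a * ((p.map (evalRingHom c)).roots.map (g.evalEval c)).prod := by
  have hdeg : p.leadingCoeff.degree = 0 := by
    by_contra h
    obtain ⟨c, hc⟩ := IsAlgClosed.exists_root p.leadingCoeff h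
    exact hp c hc
  obtain ⟨b, hb⟩ : ∃ b, p.leadingCoeff = C b := ⟨_, eq_C_of_degree_eq_zero hdeg⟩
  have hb0 : b ≠ 0 := by simpa [hb] using hp 0
  -- The formal degree of `g` is kept because its degree may drop on specialising `c`; that of `p`
  -- cannot.
  refine ⟨b ^ g.natDegree, resultant p g p.natDegree g.natDegree, pow_ne_zero _ hb0, fun c => ?_⟩
  set P := p.map (evalRingHom c) with hP
  have hPd : P.natDegree = p.natDegree :=
    natDegree_map_of_leadingCoeff_ne_zero _ (by simpa using hp c)
  have hlead : P.leadingCoeff = b := by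
    rw [leadingCoeff, hPd, hP, coeff_map, coeff_natDegree, hb]; simp
  rw [← coe_evalRingHom, ← resultant_map_map, ← hP, ← hPd,
    resultant_eq_prod_eval _ _ _ natDegree_map_le (IsAlgClosed.splits P), hlead]
  congr 3
  funext z
  exact map_evalRingHom_eval c z g

/-! ### Pigeonhole and the limit argument. -/

/-- On a plane curve inside the total filled Julia set, two different iterates of the family
coincide. -/
lemma exists_iterate_eq {p : ℂ[X][X]}
    (hp : ∀ c z, p.evalEval c z = 0 → z ∈ filledJulia c) :
    ∃ n m : ℕ, n < m ∧ ∀ c z, p.evalEval c z = 0 → (quadMap c)^[m] z = (quadMap c)^[n] z := by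
  classical
  have hlc := leadingCoeff_eval_ne_zero hp
  have hdeg : ∀ c, (p.map (evalRingHom c)).roots.card = p.natDegree := fun c =>
    (IsAlgClosed.splits _).natDegree_eq_card_roots.symm.trans
      (natDegree_map_of_leadingCoeff_ne_zero _ (by simpa using hlc c))
  have henum := fun k : ℕ => exists_fin_enumeration _ (hdeg (-(((k : ℕ) : ℝ) : ℂ) ^ 2))
  choose r hr using henum
  have hmem : ∀ (k : ℕ) i, r k i ∈ filledJulia (-((k : ℝ) : ℂ) ^ 2) := fun k i => by
    refine hp _ _ (evalEval_eq_zero_of_mem_roots ?_)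
    rw [hr]
    exact Multiset.mem_map_of_mem _ (Finset.mem_univ i)
  let w : ℕ → ℕ → Fin p.natDegree → ℂ := fun k n i => (quadMap (-((k : ℝ) : ℂ) ^ 2))^[n] (r k i)
  obtain ⟨n, m, hnm, hinf⟩ := exists_lt_infinite_setOf_eq
    (fun k n (i : Fin p.natDegree) => (decide (0 ≤ (w k n i).re), decide (0 ≤ (w k (n + 1) i).re)))
  refine ⟨n, m, hnm, fun c z hz => ?_⟩
  set S := {k : ℕ | _} with hS
  set g := iteratePoly m - iteratePoly n with hg
  have hgev : ∀ c z, g.evalEval c z = (quadMap c)^[m] z - (quadMap c)^[n] z := fun c z => by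
    rw [hg, evalEval_sub, evalEval_iteratePoly, evalEval_iteratePoly]
  set e := g.evalEval c z with he
  obtain ⟨a, R, ha, hR⟩ := exists_eval_eq_prod_roots hlc (C (C e) - g)
  have hl : (atTop ⊓ 𝓟 S : Filter ℕ).NeBot := by
    rw [← Nat.cofinite_eq_atTop]
    exact cofinite_inf_principal_neBot_iff.2 hinf
  have hnat : Tendsto (fun k : ℕ => (k : ℝ)) (atTop ⊓ 𝓟 S) atTop :=
    tendsto_natCast_atTop_atTop.mono_left inf_le_left
  have hdiff : ∀ i, Tendsto (fun k => w k m i - w k n i) (atTop ⊓ 𝓟 S) (𝓝 0) := by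
    intro i
    have hlim : Tendsto (fun k : ℕ => 6 / (2 * (k : ℝ) - 6)) (atTop ⊓ 𝓟 S) (𝓝 0) :=
      Tendsto.div_atTop tendsto_const_nhds
        (tendsto_atTop_add_const_right _ (-6) (hnat.const_mul_atTop two_pos))
    refine squeeze_zero_norm' ?_ hlim
    filter_upwards [mem_inf_of_left (Ici_mem_atTop 4), mem_inf_of_right (mem_principal_self S)]
      with k hk hkS
    have hki := congrFun (show _ = _ from hkS) i
    simp only [Prod.mk.injEq, decide_eq_decide] at hki
    refine norm_sub_le_div (by exact_mod_cast hk) (iterate_mem_filledJulia (hmem k i) _)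
      (iterate_mem_filledJulia (hmem k i) _) hki.1.symm ?_
    have := hki.2.symm
    simp only [w, Function.iterate_succ_apply'] at this
    exact this
  have hlim : Tendsto (fun k : ℕ => R.eval (-((k : ℝ) : ℂ) ^ 2)) (atTop ⊓ 𝓟 S)
      (𝓝 (a * ∏ _i : Fin p.natDegree, (e - 0))) := by
    have h1 := (tendsto_finsetProd Finset.univ fun i _ =>
      (tendsto_const_nhds (x := e)).sub (hdiff i)).const_mul a
    refine h1.congr fun k => ?_
    rw [hR, hr, Multiset.map_map]
    congr 1
    refine Finset.prod_congr rfl fun i _ => ?_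
    simp only [Function.comp_apply, evalEval_sub, evalEval_C, eval_C, hgev, w]
  have hnorm : Tendsto (fun k : ℕ => ‖-((k : ℝ) : ℂ) ^ 2‖) (atTop ⊓ 𝓟 S) atTop := by
    refine ((tendsto_pow_atTop two_ne_zero).comp hnat).congr fun k => ?_
    simp
  have hconst := eq_C_of_tendsto hnorm R hlim
  have hzr : z ∈ (p.map (evalRingHom c)).roots := by
    refine mem_roots'.2 ⟨fun h => hlc c ?_, ?_⟩
    · rw [← coe_evalRingHom, leadingCoeff, ← coeff_map, h, coeff_zero]
    · rw [IsRoot, map_evalRingHom_eval, hz]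
  have hval := hR c
  -- The factor of the norm at `z` itself is `e - e`.
  rw [Multiset.prod_eq_zero (Multiset.mem_map.2 ⟨z, hzr, by simp [he]⟩), hconst] at hval
  have he0 : e = 0 := by
    simp [ha] at hval
    exact hval.1
  rw [he, hgev] at he0
  exact sub_eq_zero.1 he0

end QuadraticFamily

theorem theorem1 (Z : Set (ℂ × ℂ)) (hZ : QuadraticFamily.IsAlgebraicCurve Z)
    (hK : Z ⊆ QuadraticFamily.filledJuliaTotal) :
    QuadraticFamily.IsPreperiodicSet QuadraticFamily.family Z := by
  obtain ⟨P, -, rfl⟩ := hZ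
  let p : Polynomial (Polynomial ℂ) :=
    MvPolynomial.aeval ![Polynomial.X, Polynomial.C Polynomial.X] P
  have hev : ∀ c z, p.evalEval c z = MvPolynomial.eval ![z, c] P := by
    intro c z
    have h : (Polynomial.evalEvalRingHom c z).comp
        (MvPolynomial.aeval (R := ℂ)
          ![Polynomial.X, Polynomial.C (Polynomial.X : Polynomial ℂ)]).toRingHom =
        MvPolynomial.eval ![z, c] := by
      refine MvPolynomial.ringHom_ext (fun a => ?_) fun i => ?_
      · simp [Polynomial.algebraMap_apply]
      · fin_cases i <;> simp
    exact congrArg (fun φ => φ P) h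
  obtain ⟨n, m, hnm, h⟩ := QuadraticFamily.exists_iterate_eq (p := p) fun c z hz =>
    hK (show (z, c) ∈ _ from (hev c z).symm.trans hz)
  refine ⟨n, m - n, by omega, Set.image_congr fun q hq => ?_⟩
  rw [Nat.add_sub_cancel' hnm.le, QuadraticFamily.iterate_family, QuadraticFamily.iterate_family,
    h q.2 q.1 ((hev _ _).trans hq)]
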